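/- Let $L$ be a first-order language, $T$ a complete $L$-theory, and $\mathcal M$ a (nonempty) $\kappa$-saturated model of $T$ for some infinite cardinal $\kappa$ (for instance a saturated monster model of $T$). View ${}^{\omega>}\omega$, the set of finite sequences of natural numbers, as a structure in the language $L_{s}=\{\unlhd,\wedge,<_{\mathrm{lex}},(P_\alpha)_{\alpha<\omega}\}$ and in the language $L_{\mathrm{str}}=\{\unlhd,\wedge,<_{\mathrm{lex}},<_{\mathrm{len}}\}$, where $\unlhd$ is the initial-segment order, $\eta\wedge\nu$ is the longest common initial segment, $<_{\mathrm{lex}}$ is the lexicographic order (proper initial segments come first), $P_\alpha$ is the set of sequences of length $\alpha$, and $\eta<_{\mathrm{len}}\nu$ means that $\eta$ is shorter than $\nu$. Let $s'\in\{s,\mathrm{str}\}$. Two finite tuples from ${}^{\omega>}\omega$ are $s'$-similar if they have the same quantifier-free $L_{s'}$-type. For a family $A=(a_\eta)_{\eta\in{}^{\omega>}\omega}$ of finite tuples, all of one length, from an $L$-structure: * $A$ is $s'$-indiscernible if $(a_{\eta_1},\dots,a_{\eta_k})$ and $(a_{\nu_1},\dots,a_{\nu_k})$ have the same complete type whenever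 $(\eta_1,\dots,\eta_k)$ and $(\nu_1,\dots,\nu_k)$ are $s'$-similar; * $\mathrm{EM}_{s'}(A)$ is the set of all formulas $\varphi(x_{\eta_1},\dots,x_{\eta_k})$ such that $\varphi(a_{\nu_1},\dots,a_{\nu_k})$ holds for every $(\nu_1,\dots,\nu_k)$ that is $s'$-similar to $(\eta_1,\dots,\eta_k)$. A property $P$ of complete $L$-theories is pre-$s'$-type if there is a partial type $\Gamma(x_\eta\mid\eta\in{}^{\omega>}\omega)$ over $\emptyset$ (where the $x_\eta$ are finite tuples of variables, all of one length) such that (1) a complete $L$-theory has $P$ if and only if $\Gamma$ is satisfiable in some model of it, and (2) $\mathrm{EM}_{s'}(A)\vdash\Gamma$ for every family $A$, in any $L$-structure, that realizes $\Gamma$; a family realizing $\Gamma$ is said to witness $P$. An $s'$-type property is a (possibly infinite) disjunction of pre-$s'$-type properties; a family witnesses it if it witnesses one of the disjuncts. Then: 1. If an $s'$-type property is witnessed by a family $(a_\eta)_{\eta\in{}^{\omega>}\omega}$ from $\mathcal M$, then it is witnessed (through the same disjunct) by an $s'$-indiscernible family $(b_\eta)_{\eta\in{}^{\omega>}\omega}$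 from $\mathcal M$. 2. If a formula $\varphi(x,y)$ and a family $(a_\eta)_{\eta\in{}^{\omega>}\omega}$ from $\mathcal M$ witness $k$-TP, then $\varphi$ witnesses $k$-TP together with some $s$-indiscernible family from $\mathcal M$. 3. If $\varphi(x,y)$ and a family $(a_\eta)_{\eta\in{}^{\omega>}\omega}$ from $\mathcal M$ witness $k$-TP$_1$ (respectively weak $k$-TP$_1$), then $\varphi$ witnesses $k$-TP$_1$ (respectively weak $k$-TP$_1$) together with some $\mathrm{str}$-indiscernible family from $\mathcal M$. Here $\varphi$ and $(a_\eta)$ witness $k$-TP if $\{\varphi(x,a_{\mu\restriction n})\mid n<\omega\}$ is consistent for every $\mu\in{}^{\omega}\omega$, while $\{\varphi(x,a_{\eta_j})\mid j<k\}$ is inconsistent for all siblings $\eta_0,\dots,\eta_{k-1}$, that is, whenever $\eta_j=\nu^\frown\langle t_j\rangle$ for some $\nu$ and distinct $t_0,\dots,t_{k-1}$. For $k$-TP$_1$ the word "siblings" is replaced by "pairwise $\unlhd$-incomparable elements", and for weak $k$-TP$_1$ by "distant siblings", which means that $\nu^\frown\langle t_j\rangle\unlhd\eta_j$ for some $\nu$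 and distinct $t_0,\dots,t_{k-1}$. -/

import Mathlib

open FirstOrder Cardinal

universe u v w x

namespace TreeIndisc

/-! ### The tree of finite sequences of natural numbers -/

/-- The underlying set of the tree of all finite sequences of natural numbers. -/
abbrev SeqTree : Type := List ℕ

/-- The meet of two finite sequences: their longest common initial segment. -/
def meet : SeqTree → SeqTree → SeqTree
  | a :: η, b :: ν => if a = b then a :: meet η ν else []
  | _, _ => []

/-- The meet is the greatest lower bound for the initial-segment order. -/
theorem prefix_meet_iff (ξ η ν : SeqTree) : ξ <+: meet η ν ↔ ξ <+: η ∧ ξ <+: ν := by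
  induction η generalizing ξ ν with
  | nil => simp only [meet, List.prefix_nil]; constructor
           · rintro rfl; exact ⟨rfl, List.nil_prefix⟩
           · exact fun h => h.1
  | cons a η ih =>
    cases ν with
    | nil => simp only [meet, List.prefix_nil]; constructor
             · rintro rfl; exact ⟨List.nil_prefix, rfl⟩
             · exact fun h => h.2
    | cons b ν =>
      cases ξ with
      | nil => simp
      | cons c ξ =>
        by_cases hab : a = b
        · subst hab
          simp only [meet, if_true, List.cons_prefix_cons, ih]
          tauto
        · simp only [meet, if_neg hab, List.cons_prefix_cons, List.prefix_nil]
          constructor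
          · intro h; cases h
          · rintro ⟨⟨rfl, -⟩, rfl, -⟩; exact absurd rfl hab

/-- The restriction of an infinite branch `μ` to its first `i` entries. -/
def restrict (μ : ℕ → ℕ) (i : ℕ) : SeqTree := List.ofFn fun j : Fin i => μ j

/-- Distinct immediate successors of one common node. -/
def AreSiblings {k : ℕ} (η : Fin k → SeqTree) : Prop :=
  ∃ (ν : SeqTree) (t : Fin k → ℕ), Function.Injective t ∧ ∀ i, η i = ν ++ [t i]

/-- Nodes that extend distinct immediate successors of one common node. -/
def AreDistantSiblings {k : ℕ} (η : Fin k → SeqTree) : Prop :=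
  ∃ (ν : SeqTree) (t : Fin k → ℕ), Function.Injective t ∧ ∀ i, ν ++ [t i] <+: η i

/-- Nodes that are pairwise incomparable for the initial-segment order. -/
def ArePairwiseIncomparable {k : ℕ} (η : Fin k → SeqTree) : Prop :=
  ∀ i j, i ≠ j → ¬ η i <+: η j

/-! ### The languages `L_s` and `L_str`, and the tree as a structure -/

/-- The function symbols of both languages: the binary symbol `∧` for the meet. -/
inductive TreeFunc : ℕ → Type
  | meet : TreeFunc 2

/-- The relation symbols of the Shelah language: initial segment, lexicographic order, and a
unary predicate for each level. -/
inductive ShelahRel : ℕ → Type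
  | initial : ShelahRel 2
  | lex : ShelahRel 2
  | level (α : ℕ) : ShelahRel 1

/-- The relation symbols of the strong Shelah language: initial segment, lexicographic order,
and comparison of lengths. -/
inductive StrongShelahRel : ℕ → Type
  | initial : StrongShelahRel 2
  | lex : StrongShelahRel 2
  | len : StrongShelahRel 2

/-- The Shelah language `L_s`. -/
def shelahLanguage : FirstOrder.Language.{0, 0} := ⟨TreeFunc, ShelahRel⟩

/-- The strong Shelah language `L_str`. -/
def strongShelahLanguage : FirstOrder.Language.{0, 0} := ⟨TreeFunc, StrongShelahRel⟩

/-- The `L_s`-structure on the tree. The order `<` on lists of natural numbers is the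
lexicographic order in which a proper initial segment precedes its extensions. -/
instance shelahStructure : shelahLanguage.Structure SeqTree where
  funMap := fun f => match f with
    | TreeFunc.meet => fun η => meet (η 0) (η 1)
  RelMap := fun r => match r with
    | ShelahRel.initial => fun η => η 0 <+: η 1
    | ShelahRel.lex => fun η => η 0 < η 1
    | ShelahRel.level α => fun η => (η 0).length = α

/-- The `L_str`-structure on the tree. -/
instance strongShelahStructure : strongShelahLanguage.Structure SeqTree where
  funMap := fun f => match f with
    | TreeFunc.meet => fun η => meet (η 0) (η 1)
  RelMap := fun r => match r with
    | StrongShelahRel.initial => fun η => η 0 <+: η 1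
    | StrongShelahRel.lex => fun η => η 0 < η 1
    | StrongShelahRel.len => fun η => (η 0).length < (η 1).length

/-! ### Indexed indiscernibles and EM-types, for an index structure `I` in a language `L'` -/

/-- `η` and `ν` have the same quantifier-free type in the `L'`-structure `I`. -/
def SameQFType (L' : FirstOrder.Language.{0, 0}) {I : Type} [L'.Structure I] {k : ℕ}
    (η ν : Fin k → I) : Prop :=
  ∀ θ : L'.Formula (Fin k), θ.IsQF → (θ.Realize η ↔ θ.Realize ν)

/-- The family `b` of `n`-tuples is `I`-indexed indiscernible: `η` and `ν` with the same
quantifier-free type in `I` give tuples `b_η` and `b_ν` with the same complete type. -/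
def IsIndiscernible (L : FirstOrder.Language.{u, v}) (L' : FirstOrder.Language.{0, 0}) {I : Type} [L'.Structure I]
    {M : Type w} [L.Structure M] {n : ℕ} (b : I → Fin n → M) : Prop :=
  ∀ (k : ℕ) (η ν : Fin k → I), SameQFType L' η ν →
    ∀ φ : L.Formula (Fin k × Fin n),
      φ.Realize (fun p => b (η p.1) p.2) ↔ φ.Realize (fun p => b (ν p.1) p.2)

/-- The EM-type of the family `a` of `n`-tuples: all formulas `φ(x_ι)` such that `φ(a_η)` holds
for every tuple `η` with the same quantifier-free type as `ι`. The variable `x_i` is itself an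
`n`-tuple, with coordinates `(i, j)`, `j : Fin n`. -/
def EMType (L : FirstOrder.Language.{u, v}) (L' : FirstOrder.Language.{0, 0}) {I : Type} [L'.Structure I]
    {M : Type w} [L.Structure M] {n : ℕ} (a : I → Fin n → M) : Set (L.Formula (I × Fin n)) :=
  {ψ | ∃ (k : ℕ) (ι : Fin k → I) (φ : L.Formula (Fin k × Fin n)),
    ψ = φ.relabel (fun p => (ι p.1, p.2)) ∧
    ∀ η : Fin k → I, SameQFType L' η ι → φ.Realize (fun p => a (η p.1) p.2)}

/-- The family `a` satisfies the partial type `Γ` under the assignment `x_i ↦ a_i`. -/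
def Satisfies {L : FirstOrder.Language.{u, v}} {I : Type} {M : Type w} [L.Structure M] {n : ℕ}
    (a : I → Fin n → M) (Γ : Set (L.Formula (I × Fin n))) : Prop :=
  ∀ ψ ∈ Γ, ψ.Realize (fun p => a p.1 p.2)

/-! ### s-type and str-type properties -/

/-- A partial type in variables `x_η`, `η` in the tree, each an `arity`-tuple. -/
structure TreePartialType (L : FirstOrder.Language.{u, v}) where
  arity : ℕ
  formulas : Set (L.Formula (SeqTree × Fin arity))

/-- `P` is a pre-`s'`-type property of complete `L`-theories with associated partial type `Γ`,
where `L'` is the language `L_s'`: a theory has `P` iff `Γ` is satisfiable in one of its models,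
and whenever `A` realizes `Γ`, the EM-type of `A` implies `Γ`. -/
structure IsPreTypeProperty (L : FirstOrder.Language.{u, v}) (L' : FirstOrder.Language.{0, 0}) [L'.Structure SeqTree]
    (P : L.Theory → Prop) (Γ : TreePartialType L) : Prop where
  has_iff : ∀ T : L.Theory, T.IsComplete →
    (P T ↔ ∃ (M : Type (max u v w)) (_ : Nonempty M) (_ : L.Structure M) (_ : M ⊨ T)
      (a : SeqTree → Fin Γ.arity → M), Satisfies a Γ.formulas)
  em_implies : ∀ (M : Type (max u v w)) [Nonempty M] [L.Structure M]
    (a : SeqTree → Fin Γ.arity → M), Satisfies a Γ.formulas →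
      ∀ (N : Type (max u v w)) [Nonempty N] [L.Structure N] (b : SeqTree → Fin Γ.arity → N),
        Satisfies b (EMType L L' a) → Satisfies b Γ.formulas

/-- `P` is an `s'`-type property: the disjunction of a (possibly infinite) family of
pre-`s'`-type properties `Q i`, with associated partial types `Γ i`. -/
def IsTypeProperty (L : FirstOrder.Language.{u, v}) (L' : FirstOrder.Language.{0, 0}) [L'.Structure SeqTree]
    (P : L.Theory → Prop) {ι : Type x} (Γ : ι → TreePartialType L) : Prop :=
  ∃ Q : ι → L.Theory → Prop, (∀ T : L.Theory, T.IsComplete → (P T ↔ ∃ i, Q i T)) ∧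
    ∀ i, IsPreTypeProperty.{u, v, w} L L' (Q i) (Γ i)

/-! ### The tree properties -/

/-- The set of formulas `φ(x, c_i)` is consistent, that is, finitely satisfiable in `M`. -/
def ConsistentFamily {L : FirstOrder.Language.{u, v}} {M : Type w} [L.Structure M] {m n : ℕ}
    (φ : L.Formula (Fin m ⊕ Fin n)) {J : Type} (c : J → Fin n → M) : Prop :=
  ∀ s : Finset J, ∃ z : Fin m → M, ∀ i ∈ s, φ.Realize (Sum.elim z (c i))

/-- Along every branch the formulas `φ(x, a_η)` are consistent, and they are inconsistent for
every `k`-tuple of nodes in `S`. -/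
def WitnessesTreeProperty {L : FirstOrder.Language.{u, v}} {M : Type w} [L.Structure M] {m n k : ℕ}
    (S : (Fin k → SeqTree) → Prop) (φ : L.Formula (Fin m ⊕ Fin n)) (a : SeqTree → Fin n → M) : Prop :=
  (∀ μ : ℕ → ℕ, ConsistentFamily φ fun i => a (restrict μ i)) ∧
    ∀ η : Fin k → SeqTree, S η → ¬ ConsistentFamily φ fun j => a (η j)

/-- `φ` and `a` witness `k`-TP. -/
def WitnessesTP {L : FirstOrder.Language.{u, v}} {M : Type w} [L.Structure M] {m n : ℕ} (k : ℕ)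
    (φ : L.Formula (Fin m ⊕ Fin n)) (a : SeqTree → Fin n → M) : Prop :=
  WitnessesTreeProperty (k := k) AreSiblings φ a

/-- `φ` and `a` witness `k`-TP₁. -/
def WitnessesTP1 {L : FirstOrder.Language.{u, v}} {M : Type w} [L.Structure M] {m n : ℕ} (k : ℕ)
    (φ : L.Formula (Fin m ⊕ Fin n)) (a : SeqTree → Fin n → M) : Prop :=
  WitnessesTreeProperty (k := k) ArePairwiseIncomparable φ a

/-- `φ` and `a` witness weak `k`-TP₁. -/
def WitnessesWeakTP1 {L : FirstOrder.Language.{u, v}} {M : Type w} [L.Structure M] {m n : ℕ} (k : ℕ)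
    (φ : L.Formula (Fin m ⊕ Fin n)) (a : SeqTree → Fin n → M) : Prop :=
  WitnessesTreeProperty (k := k) AreDistantSiblings φ a

/-! ### Saturation -/

/-- `M` is `κ`-saturated: every set of formulas in one variable over fewer than `κ` parameters
that is finitely satisfiable in `M` is satisfied by an element of `M`. -/
def IsSaturated (L : FirstOrder.Language.{u, v}) (κ : Cardinal.{w}) (M : Type w) [L.Structure M] : Prop :=
  ∀ A : Set M, #A < κ → ∀ p : Set ((L.withConstants A).Formula (Fin 1)),
    (∀ q : Finset ((L.withConstants A).Formula (Fin 1)), (q : Set _) ⊆ p →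
      ∃ z : M, ∀ φ ∈ q, φ.Realize (fun _ => z)) →
    ∃ z : M, ∀ φ ∈ p, φ.Realize (fun _ => z)

end TreeIndisc

open TreeIndisc

/-! All five conclusions follow from the modeling property: every tree-indexed family $a$ in
$\mathcal M$ admits an $s'$-indiscernible family $b$ in $\mathcal M$ realizing $\mathrm{EM}_{s'}(a)$
(`exists_indiscernible_shelah`, `exists_indiscernible_strongShelah`). For type properties, condition
(2) then makes $b$ a witness. For the tree properties, consistency of finitely many instances is one
formula, so it passes along the EM-type whenever similarity respects chains and the relevant
$k$-tuples (`WitnessesTreeProperty.of_satisfies_emType`).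

The modeling property is obtained from ultrafilters in place of a Ramsey theorem.
`genericUltrafilter` is an ultrafilter on assignments from a linear order to ℕ; generic assignments
are increasing on each finite set, and an order isomorphism between finite index sets preserves
genericity (`eventually_genericUltrafilter_congr`). An assignment $t$ determines a map of the tree
to itself. The limit along the ultrafilter of the types of $a$ composed with these maps is a
complete type in countably many variables, which saturation realizes by some $b$
(`exists_realize_ultrafilter`). As the maps generically preserve similarity, $b$ realizes the
EM-type; as similar tuples see isomorphic sets of indices, $b$ is indiscernible.

For $s$ the indices are the nodes in lexicographic order, and $t$ relabels the successors of each
node (`relabelNode`). For $\mathrm{str}$ the construction is applied a second time, to an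
$s$-indiscernible family: the indices are now the levels, and $t$ moves level $l$ to level $t(l)$
(`stretch`). In both cases quantifier-free types are first reduced to lengths of pairwise meets and
lexicographic order (`LevelSimilar`, `OrderSimilar`). -/

namespace TreeIndisc

/-! ### An ultrafilter of generic increasing assignments -/

section Generic

open Filter

variable {α : Type*} [LinearOrder α]

/-- The iterated ultrafilter on assignments `α → ℕ` in which the values at the entries of the list
are chosen one after the other, each generically for a nonprincipal ultrafilter on `ℕ`. -/
noncomputable def iterUltrafilter : List α → Ultrafilter (α → ℕ)
  | [] => pure fun _ => 0
  | v :: l => (hyperfilter ℕ).bind fun s => (iterUltrafilter l).map fun t => Function.update t v s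

theorem eventually_iterUltrafilter_cons {v : α} {l : List α} {P : (α → ℕ) → Prop} :
    (∀ᶠ t in iterUltrafilter (v :: l), P t) ↔
      ∀ᶠ s in hyperfilter ℕ, ∀ᶠ t in iterUltrafilter l, P (Function.update t v s) :=
  Iff.rfl

/-- A generic quantifier over a value on which the event does not depend is vacuous, so it can be
dropped without disturbing the order of the others. -/
theorem eventually_iterUltrafilter_sublist {l l' : List α} (h : l.Sublist l') (hl' : l'.Nodup) :
    ∀ {P : (α → ℕ) → Prop}, (∀ t t', (∀ v ∈ l, t v = t' v) → (P t ↔ P t')) →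
      ((∀ᶠ t in iterUltrafilter l', P t) ↔ ∀ᶠ t in iterUltrafilter l, P t) := by
  induction h with
  | slnil => intros; rfl
  | @cons l₁ l₂ v h ih =>
    intro P hP
    rw [List.nodup_cons] at hl'
    rw [← ih hl'.2 hP, eventually_iterUltrafilter_cons]
    have : ∀ s t, P (Function.update t v s) ↔ P t := fun s t => hP _ _ fun w hw => by
      rw [Function.update_of_ne]
      rintro rfl
      exact hl'.1 (h.subset hw)
    simp only [this, eventually_const]
  | @cons_cons l₁ l₂ v h ih =>
    intro P hP
    rw [List.nodup_cons] at hl'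
    simp only [eventually_iterUltrafilter_cons]
    refine eventually_congr (Eventually.of_forall fun s => ih hl'.2 fun t t' htt' => hP _ _ ?_)
    intro w hw
    by_cases hwv : w = v
    · subst hwv; simp
    · simp only [Function.update_of_ne hwv]
      exact htt' w ((List.mem_cons.1 hw).resolve_left hwv)

/-- The same ultrafilter on ℕ is used at each stage, so the names of the indices are irrelevant as
long as they stay distinct. -/
theorem eventually_iterUltrafilter_map {β : Type*} [LinearOrder β] (f : α → β) {l : List α} :
    ∀ {P : (α → ℕ) → Prop} {P' : (β → ℕ) → Prop}, Set.InjOn f {v | v ∈ l} →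
      (∀ t t', (∀ v ∈ l, t' (f v) = t v) → (P t ↔ P' t')) →
      ((∀ᶠ t in iterUltrafilter l, P t) ↔ ∀ᶠ t in iterUltrafilter (l.map f), P' t) := by
  induction l with
  | nil =>
    intro P P' _ h
    exact h _ _ (by simp)
  | cons v l ih =>
    intro P P' hf h
    rw [List.map_cons, eventually_iterUltrafilter_cons, eventually_iterUltrafilter_cons]
    refine eventually_congr (Eventually.of_forall fun s =>
      ih (hf.mono fun w hw => List.mem_cons_of_mem _ hw) fun t t' htt' => h _ _ ?_)
    intro w hw
    by_cases hwv : w = v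
    · subst hwv; simp
    · rw [Function.update_of_ne hwv, Function.update_of_ne]
      · exact htt' w ((List.mem_cons.1 hw).resolve_left hwv)
      · exact fun h => hwv (hf hw List.mem_cons_self h)

theorem eventually_iterUltrafilter_gt (l : List α) (c : ℕ) :
    ∀ᶠ t : α → ℕ in iterUltrafilter l, ∀ w ∈ l, c < t w := by
  induction l with
  | nil => exact Eventually.of_forall (by simp)
  | cons v l ih =>
    rw [eventually_iterUltrafilter_cons]
    filter_upwards [Nat.hyperfilter_le_atTop (eventually_gt_atTop c)] with s hs
    filter_upwards [ih] with t ht w hw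
    by_cases hwv : w = v
    · subst hwv; simpa using hs
    · rw [Function.update_of_ne hwv]
      exact ht w ((List.mem_cons.1 hw).resolve_left hwv)

/-- Each value is fixed before those after it in the list are chosen, and a nonprincipal choice
exceeds any bound fixed beforehand. -/
theorem eventually_iterUltrafilter_pairwise {l : List α} (hl : l.Nodup) :
    ∀ᶠ t : α → ℕ in iterUltrafilter l, l.Pairwise fun v w => t v < t w := by
  induction l with
  | nil => exact Eventually.of_forall (by simp)
  | cons v l ih =>
    rw [List.nodup_cons] at hl
    rw [eventually_iterUltrafilter_cons]
    refine Eventually.of_forall fun s => ?_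
    filter_upwards [ih hl.2, eventually_iterUltrafilter_gt l s] with t ht hs
    have hne : ∀ w ∈ l, w ≠ v := fun w hw h => hl.1 (h ▸ hw)
    rw [List.pairwise_cons]
    refine ⟨fun w hw => ?_, ht.imp_of_mem fun {a b} ha hb hab => ?_⟩
    · rw [Function.update_self, Function.update_of_ne (hne w hw)]
      exact hs w hw
    · rwa [Function.update_of_ne (hne a ha), Function.update_of_ne (hne b hb)]

/-- An ultrafilter on assignments `α → ℕ` restricting to `iterUltrafilter` on each finite set of
indices, in increasing order. -/
noncomputable def genericUltrafilter (α : Type*) [LinearOrder α] : Ultrafilter (α → ℕ) :=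
  (Ultrafilter.of (atTop : Filter (Finset α))).bind fun F => iterUltrafilter F.sort

/-- Every finite set containing `F` gives the same answer as `F`, so the limit over finite sets is
eventually constant. -/
theorem eventually_genericUltrafilter {F : Finset α} {P : (α → ℕ) → Prop}
    (hP : ∀ t t', (∀ v ∈ F, t v = t' v) → (P t ↔ P t')) :
    (∀ᶠ t in genericUltrafilter α, P t) ↔ ∀ᶠ t in iterUltrafilter F.sort, P t := by
  have key : ∀ᶠ F' in (Ultrafilter.of (atTop : Filter (Finset α)) : Filter (Finset α)),
      ((∀ᶠ t in iterUltrafilter F'.sort, P t) ↔ ∀ᶠ t in iterUltrafilter F.sort, P t) := by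
    filter_upwards [Ultrafilter.of_le _ (eventually_ge_atTop F)] with F' hF'
    refine eventually_iterUltrafilter_sublist ?_ (Finset.sort_nodup _ _)
      (by simpa only [Finset.mem_sort] using hP)
    refine List.sublist_of_subperm_of_sortedLE ?_ (Finset.sortedLT_sort F).sortedLE
      (Finset.sortedLT_sort F').sortedLE
    exact (Finset.sort_nodup _ _).subperm fun v hv =>
      (Finset.mem_sort _).2 (hF' ((Finset.mem_sort _).1 hv))
  have : (∀ᶠ t in genericUltrafilter α, P t) ↔
      ∀ᶠ F' in (Ultrafilter.of (atTop : Filter (Finset α)) : Filter (Finset α)),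
        ∀ᶠ t in iterUltrafilter F'.sort, P t := Iff.rfl
  rw [this, eventually_congr key, eventually_const]

theorem eventually_strictMonoOn (F : Finset α) :
    ∀ᶠ t : α → ℕ in genericUltrafilter α, StrictMonoOn t (F : Set α) := by
  rw [eventually_genericUltrafilter (F := F)]
  · filter_upwards [eventually_iterUltrafilter_pairwise (Finset.sort_nodup F (· ≤ ·))] with t ht
    intro v hv w hw hvw
    obtain ⟨i, hi, rfl⟩ := List.getElem_of_mem ((Finset.mem_sort (· ≤ ·)).2 hv)
    obtain ⟨j, hj, rfl⟩ := List.getElem_of_mem ((Finset.mem_sort (· ≤ ·)).2 hw)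
    refine List.pairwise_iff_getElem.1 ht i j hi hj (lt_of_not_ge fun hji => hvw.not_ge ?_)
    rcases hji.eq_or_lt with rfl | hji
    · exact le_rfl
    · exact (List.pairwise_iff_getElem.1 (Finset.sortedLT_sort F).pairwise j i hj hi hji).le
  · intro t t' h
    refine ⟨fun ht => ht.congr h, fun ht => ht.congr fun v hv => (h v hv).symm⟩

/-- Events that correspond under an order isomorphism between finite sets of indices are equally
generic. -/
theorem eventually_genericUltrafilter_congr {F : Finset α} {f : α → α}
    (hf : StrictMonoOn f (F : Set α)) {P P' : (α → ℕ) → Prop}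
    (h : ∀ t t', (∀ v ∈ F, t' (f v) = t v) → (P t ↔ P' t')) :
    (∀ᶠ t in genericUltrafilter α, P t) ↔ ∀ᶠ t in genericUltrafilter α, P' t := by
  classical
  -- Every assignment on `F` is transported along the injection `f`; the value 0 off the image is
  -- irrelevant. This is what shows that `P` depends only on the values on `F`.
  have hF : ∀ t : α → ℕ, ∃ t' : α → ℕ, ∀ v ∈ F, t' (f v) = t v := fun t =>
    ⟨fun w => if h : ∃ v ∈ F, f v = w then t h.choose else 0, fun v hv => by
      have h : ∃ v' ∈ F, f v' = f v := ⟨v, hv, rfl⟩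
      dsimp only
      rw [dif_pos h, hf.injOn h.choose_spec.1 hv h.choose_spec.2]⟩
  rw [eventually_genericUltrafilter (F := F), eventually_genericUltrafilter (F := F.image f),
    eventually_iterUltrafilter_map f (P' := P')]
  · suffices F.sort.map f = (F.image f).sort by rw [this]
    refine List.Perm.eq_of_sortedLE ?_ (Finset.sortedLT_sort _).sortedLE ?_
    · refine List.Pairwise.sortedLE (List.pairwise_map.2 ?_)
      refine (Finset.sortedLT_sort F).pairwise.imp_of_mem fun {a b} ha hb hab => ?_
      exact (hf ((Finset.mem_sort _).1 ha) ((Finset.mem_sort _).1 hb) hab).le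
    · refine (List.perm_ext_iff_of_nodup ?_ (Finset.sort_nodup _ _)).2 fun w => by simp
      refine (Finset.sort_nodup _ _).map_on fun a ha b hb hab => ?_
      exact hf.injOn ((Finset.mem_sort _).1 ha) ((Finset.mem_sort _).1 hb) hab
  · exact fun a ha b hb hab => hf.injOn ((Finset.mem_sort _).1 ha) ((Finset.mem_sort _).1 hb) hab
  · simpa only [Finset.mem_sort] using h
  · intro t t' htt'
    have := h (fun v => t (f v)) t fun _ _ => rfl
    rw [← this]
    exact h _ _ fun v hv => (htt' _ (Finset.mem_image_of_mem f hv)).symm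
  · intro t t' htt'
    obtain ⟨s, hs⟩ := hF t
    rw [h t s hs, h t' s fun v hv => (hs v hv).trans (htt' v hv)]

end Generic

/-! ### Realizing the type of an ultrafilter of assignments -/

section Saturation

open Filter FirstOrder.Language

variable {L : FirstOrder.Language.{u, v}} {M : Type w} [L.Structure M] {X : Type x}

theorem exists_formula_fin (ψ : L.Formula ℕ) : ∃ (m : ℕ) (ψ' : L.Formula (Fin m)),
    ∀ c : ℕ → M, ψ'.Realize (fun i => c i) ↔ ψ.Realize c := by
  obtain ⟨m, hm⟩ := ψ.freeVarFinset.bddAbove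
  refine ⟨m + 1, BoundedFormula.restrictFreeVar ψ fun i => ⟨i, Nat.lt_succ_of_le (hm i.2)⟩, ?_⟩
  intro c
  exact BoundedFormula.realize_restrictFreeVar _ fun _ => rfl

/-- A tuple realizing the type of an ultrafilter of tuples can be extended by one element. -/
theorem exists_extend_realize {κ : Cardinal.{w}} (hκ : ℵ₀ ≤ κ) (hM : IsSaturated L κ M)
    (W : Ultrafilter X) (v : X → ℕ → M) (m : ℕ) (c : Fin m → M)
    (hc : ∀ ψ : L.Formula (Fin m), ψ.Realize c ↔ ∀ᶠ x in W, ψ.Realize fun i => v x i) :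
    ∃ z : M, ∀ ψ : L.Formula (Fin (m + 1)),
      ψ.Realize (Fin.snoc c z : Fin (m + 1) → M) ↔ ∀ᶠ x in W, ψ.Realize fun i => v x i := by
  let A : Set M := Set.range c
  have hA : #A < κ := (Set.finite_range c).lt_aleph0.trans_le hκ
  -- Entries of `c` may coincide, so each parameter is assigned one index at which it occurs.
  choose r hr using fun a : A => a.2
  let g : X → A ⊕ Fin 1 → M := fun x => Sum.elim (fun a => v x (r a)) fun _ => v x m
  let p : Set ((L.withConstants A).Formula (Fin 1)) :=
    {θ | ∀ᶠ x in W, Formula.Realize (BoundedFormula.constantsVarsEquiv θ) (g x)}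
  have hreal : ∀ (θ : (L.withConstants A).Formula (Fin 1)) (z : M), θ.Realize (fun _ => z) ↔
      Formula.Realize (L := L) (BoundedFormula.constantsVarsEquiv θ)
        (Sum.elim (fun a : A => (a : M)) fun _ => z) := fun θ z =>
    BoundedFormula.realize_constantsVarsEquiv.symm
  obtain ⟨z, hz⟩ := hM A hA p fun q hq => by
    let χ : L.Formula (Fin m ⊕ Fin 1) := Formula.iInf fun θ : q =>
      Formula.relabel (Sum.map r id) (BoundedFormula.constantsVarsEquiv θ.1)
    -- Finite satisfiability: finitely many members of `p` hold simultaneously for generic `x`, with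
    -- witness `v x m`, so the existential statement is generic and therefore true of `c`.
    have hχ : (χ.iExs (Fin 1)).Realize c := by
      rw [hc]
      have : ∀ᶠ x in W, ∀ θ : q, Formula.Realize (BoundedFormula.constantsVarsEquiv θ.1) (g x) :=
        eventually_all.2 fun θ => hq θ.2
      filter_upwards [this] with x hx
      rw [Formula.realize_iExs]
      refine ⟨fun _ => v x m, ?_⟩
      rw [Formula.realize_iInf]
      intro θ
      rw [Formula.realize_relabel]
      convert hx θ using 1
      funext i
      rcases i with a | j <;> rfl
    rw [Formula.realize_iExs] at hχ
    obtain ⟨y, hy⟩ := hχ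
    rw [Formula.realize_iInf] at hy
    refine ⟨y 0, fun θ hθ => ?_⟩
    rw [hreal]
    have := hy ⟨θ, hθ⟩
    rw [Formula.realize_relabel] at this
    convert this using 1
    funext i
    rcases i with a | j
    · exact (hr a).symm
    · exact congrArg y (Subsingleton.elim _ _)
  -- The choice of indices in `r` is harmless: an equality between entries of `c` holds generically
  -- between the corresponding entries of `v x`.
  have heq : ∀ᶠ x in W, ∀ i : Fin m, v x (r ⟨c i, i, rfl⟩) = v x i := by
    refine eventually_all.2 fun i => ?_
    have := (hc (Term.equal (Term.var (r ⟨c i, i, rfl⟩)) (Term.var i))).1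
      (by rw [Formula.realize_equal]; exact hr ⟨c i, i, rfl⟩)
    filter_upwards [this] with x hx
    rwa [Formula.realize_equal] at hx
  have key : ∀ ψ : L.Formula (Fin (m + 1)), (∀ᶠ x in W, ψ.Realize fun i => v x i) →
      ψ.Realize (Fin.snoc c z : Fin (m + 1) → M) := by
    intro ψ hψ
    let e : Fin (m + 1) → A ⊕ Fin 1 :=
      Fin.snoc (α := fun _ => A ⊕ Fin 1) (fun i => Sum.inl ⟨c i, i, rfl⟩) (Sum.inr 0)
    let θ : (L.withConstants A).Formula (Fin 1) :=
      BoundedFormula.constantsVarsEquiv.symm (Formula.relabel e ψ)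
    have hθ : BoundedFormula.constantsVarsEquiv θ = Formula.relabel e ψ :=
      Equiv.apply_symm_apply _ _
    have := hz θ (by
      change ∀ᶠ x in (W : Filter X), _
      filter_upwards [hψ, heq] with x hx hex
      rw [hθ, Formula.realize_relabel]
      convert hx using 1
      funext i
      refine Fin.lastCases ?_ (fun i => ?_) i
      · simp [e, g]
      · simpa [e, g] using hex i)
    rw [hreal, hθ, Formula.realize_relabel] at this
    convert this using 1
    funext i
    refine Fin.lastCases ?_ (fun i => ?_) i <;> simp [e]
  refine ⟨z, fun ψ => ⟨fun h => ?_, key ψ⟩⟩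
  by_contra hn
  rw [← Ultrafilter.eventually_not] at hn
  exact key ψ.not (by simpa only [Formula.realize_not] using hn) h

/-- The sequence is built one entry at a time, with only finitely many parameters at each stage; a
formula mentions finitely many variables and is decided at a finite stage. -/
theorem exists_realize_nat {κ : Cardinal.{w}} (hκ : ℵ₀ ≤ κ) (hM : IsSaturated L κ M)
    (W : Ultrafilter X) (v : X → ℕ → M) :
    ∃ b : ℕ → M, ∀ ψ : L.Formula ℕ, ψ.Realize b ↔ ∀ᶠ x in W, ψ.Realize (v x) := by
  classical
  let Good (m : ℕ) (c : Fin m → M) : Prop :=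
    ∀ ψ : L.Formula (Fin m), ψ.Realize c ↔ ∀ᶠ x in W, ψ.Realize fun i => v x i
  have h0 : Good 0 Fin.elim0 := fun ψ => by
    have : ∀ x, (fun i : Fin 0 => v x i) = Fin.elim0 := fun x => Subsingleton.elim _ _
    simp only [this, eventually_const]
  choose z hz using fun m (c : {c : Fin m → M // Good m c}) =>
    exists_extend_realize hκ hM W v m c.1 c.2
  let B : ∀ m, {c : Fin m → M // Good m c} := fun m =>
    Nat.rec ⟨Fin.elim0, h0⟩ (fun m c => ⟨Fin.snoc (α := fun _ => M) c.1 (z m c), hz m c⟩) m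
  let b : ℕ → M := fun i => (B (i + 1)).1 (Fin.last i)
  have hB : ∀ m (i : Fin m), (B m).1 i = b i := by
    intro m
    induction m with
    | zero => exact fun i => i.elim0
    | succ m ih =>
      intro i
      refine Fin.lastCases rfl (fun i => ?_) i
      rw [Fin.val_castSucc, ← ih i]
      exact Fin.snoc_castSucc (α := fun _ => M) _ _ i
  refine ⟨b, fun ψ => ?_⟩
  obtain ⟨m, ψ', hψ'⟩ := exists_formula_fin (M := M) ψ
  rw [← hψ', ← (funext (hB m) : (B m).1 = fun i : Fin m => b i), (B m).2 ψ']
  simp only [hψ' (v _)]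

/-- In an `ℵ₀`-saturated structure the type of an ultrafilter of countable tuples is realized. -/
theorem exists_realize_ultrafilter [Nonempty M] {κ : Cardinal.{w}} (hκ : ℵ₀ ≤ κ)
    (hM : IsSaturated L κ M) {V : Type*} [Countable V] (W : Ultrafilter X) (v : X → V → M) :
    ∃ b : V → M, ∀ ψ : L.Formula V, ψ.Realize b ↔ ∀ᶠ x in W, ψ.Realize (v x) := by
  obtain ⟨e, he⟩ := exists_injective_nat V
  have hv : ∀ x, Function.extend e (v x) (fun _ => Classical.arbitrary M) ∘ e = v x :=
    fun x => Function.extend_comp he _ _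
  obtain ⟨b, hb⟩ := exists_realize_nat hκ hM W
    fun x => Function.extend e (v x) fun _ => Classical.arbitrary M
  refine ⟨b ∘ e, fun ψ => ?_⟩
  have := hb (ψ.relabel e)
  simpa only [Formula.realize_relabel, hv] using this

end Saturation

/-! ### Meets, initial segments and the lexicographic order -/

theorem meet_prefix_left (η ν : SeqTree) : meet η ν <+: η :=
  ((prefix_meet_iff _ _ _).1 List.prefix_rfl).1

theorem meet_prefix_right (η ν : SeqTree) : meet η ν <+: ν :=
  ((prefix_meet_iff _ _ _).1 List.prefix_rfl).2

theorem prefix_antisymm {x y : SeqTree} (h : x <+: y) (h' : y <+: x) : x = y :=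
  h.eq_of_length (le_antisymm h.length_le h'.length_le)

theorem meet_eq_left {x y : SeqTree} (h : x <+: y) : meet x y = x :=
  prefix_antisymm (meet_prefix_left x y) ((prefix_meet_iff _ _ _).2 ⟨List.prefix_rfl, h⟩)

theorem meet_eq_right {x y : SeqTree} (h : y <+: x) : meet x y = y :=
  prefix_antisymm (meet_prefix_right x y) ((prefix_meet_iff _ _ _).2 ⟨h, List.prefix_rfl⟩)

theorem meet_self (x : SeqTree) : meet x x = x := meet_eq_left List.prefix_rfl

/-- Initial segments of `η` and of `ν` coincide exactly up to the length of `meet η ν`, so lengths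
alone decide how they compare. -/
theorem prefix_iff_length_le {x y η ν : SeqTree} (hx : x <+: η) (hy : y <+: ν) :
    x <+: y ↔ x.length ≤ y.length ∧ x.length ≤ (meet η ν).length := by
  refine ⟨fun h => ⟨h.length_le, ?_⟩, fun ⟨h, h'⟩ => ?_⟩
  · exact ((prefix_meet_iff x η ν).2 ⟨hx, h.trans hy⟩).length_le
  · have hxm := List.prefix_of_prefix_length_le hx (meet_prefix_left η ν) h'
    exact List.prefix_of_prefix_length_le (hxm.trans (meet_prefix_right η ν)) hy h

theorem eq_iff_length_eq {x y η ν : SeqTree} (hx : x <+: η) (hy : y <+: ν) :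
    x = y ↔ x.length = y.length ∧ x.length ≤ (meet η ν).length := by
  refine ⟨?_, fun ⟨h, h'⟩ => ((prefix_iff_length_le hx hy).2 ⟨h.le, h'⟩).eq_of_length h⟩
  rintro rfl
  exact ⟨rfl, ((prefix_iff_length_le hx hy).1 List.prefix_rfl).2⟩

theorem meet_eq_meet {x y η ν : SeqTree} (hx : x <+: η) (hy : y <+: ν)
    (h : (meet η ν).length ≤ x.length) (h' : (meet η ν).length ≤ y.length) :
    meet x y = meet η ν := by
  refine prefix_antisymm ?_ ?_
  · exact (prefix_meet_iff _ _ _).2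
      ⟨(meet_prefix_left x y).trans hx, (meet_prefix_right x y).trans hy⟩
  · exact (prefix_meet_iff _ _ _).2
      ⟨List.prefix_of_prefix_length_le (meet_prefix_left η ν) hx h,
        List.prefix_of_prefix_length_le (meet_prefix_right η ν) hy h'⟩

theorem le_of_prefix {x y : SeqTree} (h : x <+: y) : x ≤ y := by
  induction x generalizing y with
  | nil => exact not_lt.1 (List.not_lt_nil y)
  | cons a x ih =>
    cases y with
    | nil => exact absurd h (by simp)
    | cons b y =>
      obtain ⟨rfl, h'⟩ := List.cons_prefix_cons.1 h
      rw [← not_lt, List.cons_lt_cons_iff]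
      rintro (h₁ | h₁)
      exacts [lt_irrefl _ h₁, (ih h').not_gt h₁.2]

theorem append_lt_append_iff {x y : SeqTree} (h : ¬ x <+: y) (h' : ¬ y <+: x) (s r : SeqTree) :
    x ++ s < y ++ r ↔ x < y := by
  induction x generalizing y with
  | nil => exact absurd List.nil_prefix h
  | cons a x ih =>
    cases y with
    | nil => exact absurd List.nil_prefix h'
    | cons b y =>
      simp only [List.cons_append, List.cons_lt_cons_iff]
      by_cases hab : a = b
      · subst hab
        simp only [List.cons_prefix_cons, true_and] at h h'
        simp only [lt_irrefl, true_and, false_or, ih h h']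
      · simp only [hab, false_and]

/-- Either `x` is a proper initial segment of `y`, or both reach past the point where `η` and `ν`
split and the order is decided there. -/
theorem lt_iff_length {x y η ν : SeqTree} (hx : x <+: η) (hy : y <+: ν) :
    x < y ↔ (x.length < y.length ∧ x.length ≤ (meet η ν).length) ∨
      ((meet η ν).length < x.length ∧ (meet η ν).length < y.length ∧ η < ν) := by
  have hm : (meet ν η).length = (meet η ν).length :=
    congrArg _ (prefix_antisymm
      ((prefix_meet_iff _ _ _).2 ⟨meet_prefix_right _ _, meet_prefix_left _ _⟩)
      ((prefix_meet_iff _ _ _).2 ⟨meet_prefix_right _ _, meet_prefix_left _ _⟩))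
  have h₁ := prefix_iff_length_le hx hy
  have h₂ := prefix_iff_length_le hy hx
  rw [hm] at h₂
  by_cases hxy : x <+: y
  · rw [(le_of_prefix hxy).lt_iff_ne, Ne, eq_iff_length_eq hx hy]
    have := h₁.1 hxy
    constructor
    · intro h; left; omega
    · rintro (h | h) <;> omega
  by_cases hyx : y <+: x
  · rw [← not_le]
    simp only [le_of_prefix hyx, not_true, false_iff]
    have := h₂.1 hyx
    rintro (h | h) <;> omega
  obtain ⟨s, rfl⟩ := hx
  obtain ⟨r, rfl⟩ := hy
  rw [append_lt_append_iff hxy hyx]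
  rw [h₁] at hxy
  rw [h₂] at hyx
  constructor
  · intro h; exact Or.inr ⟨by omega, by omega, h⟩
  · rintro (h | h)
    · omega
    · exact h.2.2

/-! ### Quantifier-free types in the tree -/

section Similar

variable {k : ℕ}

/-- The tuples have meets of the same lengths and the same lexicographic order. -/
structure LevelSimilar (η ν : Fin k → SeqTree) : Prop where
  length_meet : ∀ i j, (meet (η i) (η j)).length = (meet (ν i) (ν j)).length
  lt_iff : ∀ i j, η i < η j ↔ ν i < ν j

/-- The tuples have meets with lengths in the same order and the same lexicographic order. -/
structure OrderSimilar (η ν : Fin k → SeqTree) : Prop where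
  length_lt : ∀ i i' j j', (meet (η i) (η i')).length < (meet (η j) (η j')).length ↔
    (meet (ν i) (ν i')).length < (meet (ν j) (ν j')).length
  lt_iff : ∀ i j, η i < η j ↔ ν i < ν j

variable {η ν ξ : Fin k → SeqTree}

theorem LevelSimilar.orderSimilar (h : LevelSimilar η ν) : OrderSimilar η ν :=
  ⟨fun i i' j j' => by rw [h.length_meet, h.length_meet], h.lt_iff⟩

theorem LevelSimilar.length (h : LevelSimilar η ν) (i : Fin k) :
    (η i).length = (ν i).length := by
  simpa only [meet_self] using h.length_meet i i

theorem OrderSimilar.symm (h : OrderSimilar η ν) : OrderSimilar ν η :=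
  ⟨fun i i' j j' => (h.length_lt i i' j j').symm, fun i j => (h.lt_iff i j).symm⟩

theorem OrderSimilar.trans (h : OrderSimilar η ν) (h' : OrderSimilar ν ξ) : OrderSimilar η ξ :=
  ⟨fun i i' j j' => (h.length_lt i i' j j').trans (h'.length_lt i i' j j'),
    fun i j => (h.lt_iff i j).trans (h'.lt_iff i j)⟩

theorem OrderSimilar.length_le (h : OrderSimilar η ν) (i i' j j' : Fin k) :
    (meet (η i) (η i')).length ≤ (meet (η j) (η j')).length ↔
      (meet (ν i) (ν i')).length ≤ (meet (ν j) (ν j')).length := by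
  rw [← not_lt, ← not_lt, h.length_lt]

theorem OrderSimilar.length_eq (h : OrderSimilar η ν) (i i' j j' : Fin k) :
    (meet (η i) (η i')).length = (meet (η j) (η j')).length ↔
      (meet (ν i) (ν i')).length = (meet (ν j) (ν j')).length := by
  rw [le_antisymm_iff, le_antisymm_iff, h.length_le, h.length_le]

/-- The nodes `x` and `y` are the meets of corresponding pairs of entries of `η` and `ν`. -/
def CorrMeet (η ν : Fin k → SeqTree) (x y : SeqTree) : Prop :=
  ∃ i i', x = meet (η i) (η i') ∧ y = meet (ν i) (ν i')

theorem OrderSimilar.prefix_iff (h : OrderSimilar η ν) {x y x' y' : SeqTree}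
    (hx : CorrMeet η ν x x') (hy : CorrMeet η ν y y') : x <+: y ↔ x' <+: y' := by
  obtain ⟨i, i', rfl, rfl⟩ := hx
  obtain ⟨j, j', rfl, rfl⟩ := hy
  rw [prefix_iff_length_le (meet_prefix_left _ _) (meet_prefix_left _ _),
    prefix_iff_length_le (meet_prefix_left _ _) (meet_prefix_left _ _), h.length_le, h.length_le]

theorem OrderSimilar.eq_iff (h : OrderSimilar η ν) {x y x' y' : SeqTree}
    (hx : CorrMeet η ν x x') (hy : CorrMeet η ν y y') : x = y ↔ x' = y' := by
  obtain ⟨i, i', rfl, rfl⟩ := hx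
  obtain ⟨j, j', rfl, rfl⟩ := hy
  rw [eq_iff_length_eq (meet_prefix_left _ _) (meet_prefix_left _ _),
    eq_iff_length_eq (meet_prefix_left _ _) (meet_prefix_left _ _), h.length_eq, h.length_le]

theorem OrderSimilar.lt_iff_of_corrMeet (h : OrderSimilar η ν) {x y x' y' : SeqTree}
    (hx : CorrMeet η ν x x') (hy : CorrMeet η ν y y') : x < y ↔ x' < y' := by
  obtain ⟨i, i', rfl, rfl⟩ := hx
  obtain ⟨j, j', rfl, rfl⟩ := hy
  rw [lt_iff_length (meet_prefix_left _ _) (meet_prefix_left _ _),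
    lt_iff_length (meet_prefix_left _ _) (meet_prefix_left _ _), h.length_lt, h.length_lt,
    h.length_lt, h.length_le, h.lt_iff]

theorem OrderSimilar.length_lt_iff (h : OrderSimilar η ν) {x y x' y' : SeqTree}
    (hx : CorrMeet η ν x x') (hy : CorrMeet η ν y y') :
    x.length < y.length ↔ x'.length < y'.length := by
  obtain ⟨i, i', rfl, rfl⟩ := hx
  obtain ⟨j, j', rfl, rfl⟩ := hy
  exact h.length_lt _ _ _ _

/-- The pairwise meets of a tuple are closed under meets: two incomparable ones lie below entries
that split exactly where they do. Hence terms produce no further nodes. -/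
theorem OrderSimilar.corrMeet_meet (h : OrderSimilar η ν) {x y x' y' : SeqTree}
    (hx : CorrMeet η ν x x') (hy : CorrMeet η ν y y') : CorrMeet η ν (meet x y) (meet x' y') := by
  by_cases hxy : x <+: y
  · rwa [meet_eq_left hxy, meet_eq_left ((h.prefix_iff hx hy).1 hxy)]
  by_cases hyx : y <+: x
  · rwa [meet_eq_right hyx, meet_eq_right ((h.prefix_iff hy hx).1 hyx)]
  have key : ∀ {ξ : Fin k → SeqTree} {i i' j j' : Fin k},
      ¬ meet (ξ i) (ξ i') <+: meet (ξ j) (ξ j') → ¬ meet (ξ j) (ξ j') <+: meet (ξ i) (ξ i') →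
      meet (meet (ξ i) (ξ i')) (meet (ξ j) (ξ j')) = meet (ξ i) (ξ j) := by
    intro ξ i i' j j' h h'
    have hi := meet_prefix_left (ξ i) (ξ i')
    have hj := meet_prefix_left (ξ j) (ξ j')
    have hm := meet_prefix_left (ξ i) (ξ j)
    have hm' := meet_prefix_right (ξ i) (ξ j)
    refine meet_eq_meet hi hj (le_of_lt (lt_of_not_ge fun hle => ?_))
      (le_of_lt (lt_of_not_ge fun hle => ?_))
    · have := (List.prefix_of_prefix_length_le hi hm hle).trans hm'
      rcases List.prefix_or_prefix_of_prefix this hj with h₁ | h₁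
      exacts [h h₁, h' h₁]
    · have := (List.prefix_of_prefix_length_le hj hm' hle).trans hm
      rcases List.prefix_or_prefix_of_prefix hi this with h₁ | h₁
      exacts [h h₁, h' h₁]
  have hxy' := mt (h.prefix_iff hx hy).2 hxy
  have hyx' := mt (h.prefix_iff hy hx).2 hyx
  obtain ⟨i, i', rfl, rfl⟩ := hx
  obtain ⟨j, j', rfl, rfl⟩ := hy
  exact ⟨i, j, key hxy hyx, key hxy' hyx'⟩

open FirstOrder.Language in
/-- Order similar tuples have the same quantifier-free type in a language whose functions are meets
and whose relations do not distinguish corresponding meets. -/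
theorem OrderSimilar.sameQFType (h : OrderSimilar η ν) (L' : FirstOrder.Language.{0, 0})
    [L'.Structure SeqTree]
    (hfun : ∀ (n : ℕ) (f : L'.Functions n), ∃ p q : Fin n, ∀ x : Fin n → SeqTree,
      Structure.funMap f x = meet (x p) (x q))
    (hrel : ∀ (n : ℕ) (R : L'.Relations n) (x y : Fin n → SeqTree),
      (∀ p, CorrMeet η ν (x p) (y p)) → (Structure.RelMap R x ↔ Structure.RelMap R y)) :
    SameQFType L' η ν := by
  have hterm : ∀ (τ : L'.Term (Fin k ⊕ Fin 0)) (e e' : Fin 0 → SeqTree),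
      CorrMeet η ν (τ.realize (Sum.elim η e)) (τ.realize (Sum.elim ν e')) := by
    intro τ e e'
    induction τ with
    | var i =>
      rcases i with i | i
      · exact ⟨i, i, (meet_self _).symm, (meet_self _).symm⟩
      · exact i.elim0
    | func f ts ih =>
      obtain ⟨p, q, hf⟩ := hfun _ f
      rw [Term.realize_func, Term.realize_func, hf, hf]
      exact h.corrMeet_meet (ih p) (ih q)
  intro θ hθ
  unfold Formula.Realize
  induction hθ with
  | falsum => rfl
  | of_isAtomic hφ =>
    cases hφ with
    | equal t₁ t₂ =>
      rw [BoundedFormula.realize_bdEqual, BoundedFormula.realize_bdEqual]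
      exact h.eq_iff (hterm t₁ _ _) (hterm t₂ _ _)
    | rel R ts =>
      rw [BoundedFormula.realize_rel, BoundedFormula.realize_rel]
      exact hrel _ R _ _ fun p => hterm (ts p) _ _
  | imp _ _ ih₁ ih₂ =>
    rw [BoundedFormula.realize_imp, BoundedFormula.realize_imp, ih₁, ih₂]

open FirstOrder.Language in
-- The level predicates applied to meets read off exact lengths.
theorem sameQFType_shelah_iff : SameQFType shelahLanguage η ν ↔ LevelSimilar η ν := by
  constructor
  · intro h
    refine ⟨fun i j => ?_, fun i j => ?_⟩
    · let f : shelahLanguage.Functions 2 := TreeFunc.meet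
      let R : shelahLanguage.Relations 1 := ShelahRel.level (meet (η i) (η j)).length
      have := (h (R.formula₁ (f.apply₂ (Term.var i) (Term.var j)))
        (BoundedFormula.IsAtomic.rel _ _).isQF)
      rw [Formula.realize_rel₁, Formula.realize_rel₁, Term.realize_functions_apply₂,
        Term.realize_functions_apply₂] at this
      exact (this.1 rfl).symm
    · let R : shelahLanguage.Relations 2 := ShelahRel.lex
      have := (h (R.formula₂ (Term.var i) (Term.var j)) (BoundedFormula.IsAtomic.rel _ _).isQF)
      rwa [Formula.realize_rel₂, Formula.realize_rel₂] at this
  · intro h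
    refine h.orderSimilar.sameQFType _ (fun n f => ?_) fun n R x y hxy => ?_
    · cases f with
      | meet => exact ⟨0, 1, fun x => rfl⟩
    · cases R with
      | initial => exact h.orderSimilar.prefix_iff (hxy 0) (hxy 1)
      | lex => exact h.orderSimilar.lt_iff_of_corrMeet (hxy 0) (hxy 1)
      | level α =>
        obtain ⟨i, j, hx, hy⟩ := hxy 0
        change (x 0).length = α ↔ (y 0).length = α
        rw [hx, hy, h.length_meet]

open FirstOrder.Language in
-- Without level predicates only comparisons between lengths of meets can be expressed.
theorem sameQFType_strongShelah_iff : SameQFType strongShelahLanguage η ν ↔ OrderSimilar η ν := by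
  constructor
  · intro h
    refine ⟨fun i i' j j' => ?_, fun i j => ?_⟩
    · let f : strongShelahLanguage.Functions 2 := TreeFunc.meet
      let R : strongShelahLanguage.Relations 2 := StrongShelahRel.len
      have := (h (R.formula₂ (f.apply₂ (Term.var i) (Term.var i'))
        (f.apply₂ (Term.var j) (Term.var j'))) (BoundedFormula.IsAtomic.rel _ _).isQF)
      simp only [Formula.realize_rel₂, Term.realize_functions_apply₂] at this
      exact this
    · let R : strongShelahLanguage.Relations 2 := StrongShelahRel.lex
      have := (h (R.formula₂ (Term.var i) (Term.var j)) (BoundedFormula.IsAtomic.rel _ _).isQF)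
      rwa [Formula.realize_rel₂, Formula.realize_rel₂] at this
  · intro h
    refine h.sameQFType _ (fun n f => ?_) fun n R x y hxy => ?_
    · cases f with
      | meet => exact ⟨0, 1, fun x => rfl⟩
    · cases R with
      | initial => exact h.prefix_iff (hxy 0) (hxy 1)
      | lex => exact h.lt_iff_of_corrMeet (hxy 0) (hxy 1)
      | len => exact h.length_lt_iff (hxy 0) (hxy 1)

end Similar

/-! ### Embeddings of the tree that preserve levels -/

/-- The node whose entries are the values of `t` at the nonempty initial segments of a node. -/
def relabelNode : (SeqTree → ℕ) → SeqTree → SeqTree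
  | _, [] => []
  | t, a :: η => t [a] :: relabelNode (fun l => t (a :: l)) η

theorem length_relabelNode (t : SeqTree → ℕ) (η : SeqTree) :
    (relabelNode t η).length = η.length := by
  induction η generalizing t with
  | nil => rfl
  | cons a η ih => simp [relabelNode, ih]

theorem relabelNode_congr {t t' : SeqTree → ℕ} {η ν : SeqTree} (hl : η.length = ν.length)
    (h : ∀ j ≤ η.length, t (η.take j) = t' (ν.take j)) : relabelNode t η = relabelNode t' ν := by
  induction η generalizing t t' ν with
  | nil => rw [List.length_eq_zero_iff.1 hl.symm]; rfl
  | cons a η ih =>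
    cases ν with
    | nil => exact absurd hl (by simp)
    | cons b ν =>
      have h₁ := h 1 (by simp)
      simp only [List.take_succ_cons, List.take_zero] at h₁
      rw [relabelNode, relabelNode, h₁, ih (t := fun l => t (a :: l)) (t' := fun l => t' (b :: l))
        (by simpa using hl)]
      intro j hj
      simpa using h (j + 1) (by simpa using hj)

/-- An assignment that is lexicographically increasing on the initial segments involved is in
particular increasing on siblings among them, so it relabels successors without merging or
reordering them. The induction passes to the subtree above the common first entry. -/
theorem relabelNode_spec {t : SeqTree → ℕ} {S : Set SeqTree} (ht : StrictMonoOn t S)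
    {η ν : SeqTree} (hη : ∀ p, p <+: η → p ∈ S) (hν : ∀ p, p <+: ν → p ∈ S) :
    meet (relabelNode t η) (relabelNode t ν) = relabelNode t (meet η ν) ∧
      (η < ν → relabelNode t η < relabelNode t ν) := by
  induction η generalizing t S ν with
  | nil =>
    cases ν with
    | nil => exact ⟨rfl, fun h => absurd h (lt_irrefl _)⟩
    | cons b ν => exact ⟨rfl, fun _ => by simp [relabelNode]⟩
  | cons a η ih =>
    cases ν with
    | nil => exact ⟨rfl, fun h => absurd h (by simp)⟩
    | cons b ν =>
      have ha : [a] ∈ S := hη _ (by simp)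
      have hb : [b] ∈ S := hν _ (by simp)
      by_cases hab : a = b
      · subst hab
        have := ih (t := fun l => t (a :: l)) (S := {l | a :: l ∈ S}) (ν := ν)
          (fun l hl l' hl' hll' => ht hl hl' (List.cons_lt_cons_iff.2 (Or.inr ⟨rfl, hll'⟩)))
          (fun p hp => hη _ (by simpa using hp)) (fun p hp => hν _ (by simpa using hp))
        simp only [relabelNode, meet, if_true, this.1, List.cons_lt_cons_iff, lt_irrefl, true_and,
          false_or]
        exact this.2
      · have hne : t [a] ≠ t [b] := fun h => hab (by simpa using ht.injOn ha hb h)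
        simp only [relabelNode, meet, if_neg hne, if_neg hab, List.cons_lt_cons_iff, true_and]
        rintro (h | h)
        · exact Or.inl (ht ha hb (List.cons_lt_cons_iff.2 (Or.inl h)))
        · exact absurd h.1 hab

theorem lt_iff_of_imp {g : SeqTree → SeqTree} {η ν : SeqTree} (h : η < ν → g η < g ν)
    (h' : ν < η → g ν < g η) : g η < g ν ↔ η < ν := by
  refine ⟨fun hg => ?_, h⟩
  rcases lt_trichotomy η ν with h₁ | h₁ | h₁
  · exact h₁
  · exact absurd hg (h₁ ▸ lt_irrefl _)
  · exact absurd hg (h' h₁).asymm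

/-- The finite set of all initial segments of the entries of a tuple. -/
def initials {k : ℕ} (η : Fin k → SeqTree) : Finset SeqTree :=
  Finset.univ.biUnion fun i => (η i).inits.toFinset

theorem mem_initials {k : ℕ} {η : Fin k → SeqTree} {p : SeqTree} :
    p ∈ initials η ↔ ∃ i, p <+: η i := by
  simp [initials]

theorem levelSimilar_relabelNode {k : ℕ} {t : SeqTree → ℕ} {η : Fin k → SeqTree}
    (ht : StrictMonoOn t (initials η : Set SeqTree)) :
    LevelSimilar (fun i => relabelNode t (η i)) η := by
  have hS : ∀ i p, p <+: η i → p ∈ (initials η : Set SeqTree) := fun i p hp =>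
    mem_initials.2 ⟨i, hp⟩
  refine ⟨fun i j => ?_, fun i j => ?_⟩
  · rw [(relabelNode_spec ht (hS i) (hS j)).1, length_relabelNode]
  · exact lt_iff_of_imp (relabelNode_spec ht (hS i) (hS j)).2 (relabelNode_spec ht (hS j) (hS i)).2

/-- Level similar tuples have isomorphic sets of initial segments. -/
theorem LevelSimilar.exists_initials_iso {k : ℕ} {η ν : Fin k → SeqTree} (h : LevelSimilar η ν) :
    ∃ f : SeqTree → SeqTree, StrictMonoOn f (initials η : Set SeqTree) ∧
      ∀ i, ∀ j ≤ (η i).length, f ((η i).take j) = (ν i).take j := by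
  classical
  -- The choice of the entry above `p` does not matter: if two entries share `p`, the corresponding
  -- entries of `ν` agree up to that length, as their meet is equally long.
  let f : SeqTree → SeqTree := fun p =>
    if hp : ∃ i, p <+: η i then (ν hp.choose).take p.length else p
  have hf : ∀ i p, p <+: η i → f p = (ν i).take p.length := by
    intro i p hp
    have hex : ∃ i, p <+: η i := ⟨i, hp⟩
    simp only [f, dif_pos hex]
    have hle := h.length hex.choose ▸ hex.choose_spec.length_le
    have hle' := h.length i ▸ hp.length_le
    rw [eq_iff_length_eq (List.take_prefix _ _) (List.take_prefix _ _), List.length_take_of_le hle,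
      List.length_take_of_le hle', ← h.length_meet]
    exact ⟨rfl, ((prefix_meet_iff _ _ _).2 ⟨hex.choose_spec, hp⟩).length_le⟩
  refine ⟨f, fun p hp q hq hpq => ?_, fun i j hj => ?_⟩
  · obtain ⟨i, hi⟩ := mem_initials.1 hp
    obtain ⟨j, hj⟩ := mem_initials.1 hq
    have hle := h.length i ▸ hi.length_le
    have hle' := h.length j ▸ hj.length_le
    rw [hf i p hi, hf j q hj, lt_iff_length (List.take_prefix _ _) (List.take_prefix _ _),
      List.length_take_of_le hle, List.length_take_of_le hle', ← h.length_meet, ← h.lt_iff,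
      ← lt_iff_length hi hj]
    exact hpq
  · rw [hf i _ (List.take_prefix _ _), List.length_take_of_le hj]

/-! ### Embeddings of the tree that stretch levels -/

/-- The image of a node under the embedding that sends level `l` to level `h l`, padding with
zeros. -/
def stretch : (ℕ → ℕ) → SeqTree → SeqTree
  | h, [] => List.replicate (h 0) 0
  | h, a :: η => List.replicate (h 0) 0 ++ a :: stretch (fun l => h (l + 1) - h 0 - 1) η

/-- What remains of the level map after the block of `h 0` zeros and one original entry have been
consumed. -/
theorem strictMono_shift {h : ℕ → ℕ} (hh : StrictMono h) :
    StrictMono fun l => h (l + 1) - h 0 - 1 := by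
  intro l l' hl
  have h₁ : h 0 < h (l + 1) := hh (Nat.succ_pos l)
  have h₂ : h (l + 1) < h (l' + 1) := hh (Nat.succ_lt_succ hl)
  dsimp only
  omega

theorem length_stretch {h : ℕ → ℕ} (hh : StrictMono h) (η : SeqTree) :
    (stretch h η).length = h η.length := by
  induction η generalizing h with
  | nil => simp [stretch]
  | cons a η ih =>
    have h₁ : h 0 < h (η.length + 1) := hh (Nat.succ_pos _)
    simp only [stretch, List.length_append, List.length_replicate, List.length_cons,
      ih (strictMono_shift hh)]
    omega

theorem meet_append (r x y : SeqTree) : meet (r ++ x) (r ++ y) = r ++ meet x y := by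
  induction r with
  | nil => rfl
  | cons a r ih => simp [meet, ih]

theorem append_lt_append_left_iff (r x y : SeqTree) : r ++ x < r ++ y ↔ x < y := by
  induction r with
  | nil => rfl
  | cons a r ih => simp [ih]

/-- The padding precedes each entry, so nodes that split at an entry still split at that entry,
after a common block of zeros. -/
theorem meet_stretch (h : ℕ → ℕ) (η ν : SeqTree) :
    meet (stretch h η) (stretch h ν) = stretch h (meet η ν) := by
  induction η generalizing h ν with
  | nil =>
    cases ν with
    | nil => exact meet_self _
    | cons b ν => exact meet_eq_left (List.prefix_append _ _)
  | cons a η ih =>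
    cases ν with
    | nil => exact meet_eq_right (List.prefix_append _ _)
    | cons b ν =>
      rw [stretch, stretch, meet_append]
      by_cases hab : a = b
      · subst hab
        simp only [meet, if_true, stretch, ih]
      · simp only [meet, if_neg hab, stretch, List.append_nil]

theorem stretch_lt_stretch (h : ℕ → ℕ) {η ν : SeqTree} (hlt : η < ν) :
    stretch h η < stretch h ν := by
  induction η generalizing h ν with
  | nil =>
    cases ν with
    | nil => exact absurd hlt (lt_irrefl _)
    | cons b ν =>
      rw [stretch, stretch]
      conv_lhs => rw [← List.append_nil (List.replicate (h 0) 0)]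
      rw [append_lt_append_left_iff]
      simp
  | cons a η ih =>
    cases ν with
    | nil => exact absurd hlt (by simp)
    | cons b ν =>
      rw [stretch, stretch, append_lt_append_left_iff]
      rw [List.cons_lt_cons_iff] at hlt ⊢
      exact hlt.imp_right fun h' => ⟨h'.1, ih _ h'.2⟩

theorem length_meet_stretch {h : ℕ → ℕ} (hh : StrictMono h) (η ν : SeqTree) :
    (meet (stretch h η) (stretch h ν)).length = h (meet η ν).length := by
  rw [meet_stretch, length_stretch hh]

theorem orderSimilar_stretch {h : ℕ → ℕ} (hh : StrictMono h) {k : ℕ} (η : Fin k → SeqTree) :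
    OrderSimilar (fun i => stretch h (η i)) η :=
  ⟨fun i i' j j' => by rw [length_meet_stretch hh, length_meet_stretch hh, hh.lt_iff_lt],
    fun _ _ => lt_iff_of_imp (stretch_lt_stretch h) (stretch_lt_stretch h)⟩

/-- The least strictly increasing function above `t`. -/
def increasing (t : ℕ → ℕ) : ℕ → ℕ
  | 0 => t 0
  | l + 1 => max (t (l + 1)) (increasing t l + 1)

theorem strictMono_increasing (t : ℕ → ℕ) : StrictMono (increasing t) :=
  strictMono_nat_of_lt_succ fun _ => (Nat.lt_succ_self _).trans_le (le_max_right _ _)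

/-- Passing to `increasing t` makes every assignment a legitimate level map, while changing nothing
on the levels where `t` already increases. -/
theorem increasing_eq {t : ℕ → ℕ} {N : ℕ} (ht : StrictMonoOn t (Finset.Iic N : Set ℕ)) {l : ℕ}
    (hl : l ≤ N) : increasing t l = t l := by
  induction l with
  | zero => rfl
  | succ l ih =>
    rw [increasing, ih (by omega)]
    exact max_eq_left (ht (by simpa using by omega) (by simpa using hl) (Nat.lt_succ_self l))

/-! ### The modeling property -/

section Modeling

open Filter FirstOrder.Language

variable {L : FirstOrder.Language.{u, v}} {M : Type w} [L.Structure M] [Nonempty M]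
  {κ : Cardinal.{w}} {n : ℕ}

/-- In an `ℵ₀`-saturated structure every tree-indexed family has an `s`-indiscernible family
realizing its EM-type. -/
theorem exists_indiscernible_shelah (hκ : ℵ₀ ≤ κ) (hM : IsSaturated L κ M)
    (a : SeqTree → Fin n → M) :
    ∃ b : SeqTree → Fin n → M, Satisfies b (EMType L shelahLanguage a) ∧
      IsIndiscernible L shelahLanguage b := by
  obtain ⟨b, hb⟩ := exists_realize_ultrafilter hκ hM (genericUltrafilter SeqTree)
    fun t (p : SeqTree × Fin n) => a (relabelNode t p.1) p.2
  have hb' : ∀ {k : ℕ} (φ : L.Formula (Fin k × Fin n)) (η : Fin k → SeqTree),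
      φ.Realize (fun p => b (η p.1, p.2)) ↔ ∀ᶠ t in (genericUltrafilter SeqTree : Filter _),
        φ.Realize fun p => a (relabelNode t (η p.1)) p.2 := fun φ η => by
    have := hb (φ.relabel fun p => (η p.1, p.2))
    simp only [Formula.realize_relabel] at this
    exact this
  refine ⟨fun i j => b (i, j), ?_, ?_⟩
  · rintro ψ ⟨k, ι, φ, rfl, hφ⟩
    rw [Formula.realize_relabel]
    refine (hb' φ ι).2 ?_
    filter_upwards [eventually_strictMonoOn (initials ι)] with t ht
    exact hφ _ (sameQFType_shelah_iff.2 (levelSimilar_relabelNode ht))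
  · intro k η ν h φ
    rw [sameQFType_shelah_iff] at h
    rw [hb', hb']
    obtain ⟨f, hf, hfη⟩ := h.exists_initials_iso
    refine eventually_genericUltrafilter_congr hf fun t t' htt' => ?_
    have : ∀ i, relabelNode t (η i) = relabelNode t' (ν i) := fun i =>
      relabelNode_congr (h.length i) fun j hj => by
        rw [← hfη i j hj, htt' _ (mem_initials.2 ⟨i, List.take_prefix _ _⟩)]
    simp only [this]

/-- Order similar tuples have sets of levels that are isomorphic as orders. -/
theorem OrderSimilar.exists_levels_iso {k : ℕ} {η ν : Fin k → SeqTree} (h : OrderSimilar η ν) :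
    ∃ (F : Finset ℕ) (f : ℕ → ℕ), StrictMonoOn f (F : Set ℕ) ∧
      (∀ i j, (meet (η i) (η j)).length ∈ F) ∧
      ∀ i j, f (meet (η i) (η j)).length = (meet (ν i) (ν j)).length := by
  classical
  let len : Fin k × Fin k → ℕ := fun p => (meet (η p.1) (η p.2)).length
  let len' : Fin k × Fin k → ℕ := fun p => (meet (ν p.1) (ν p.2)).length
  have hf : ∀ p, Function.extend len len' (fun _ => 0) (len p) = len' p :=
    fun p => Function.FactorsThrough.extend_apply
      (fun p q hpq => (h.length_eq p.1 p.2 q.1 q.2).1 hpq) _ _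
  refine ⟨Finset.univ.image len, Function.extend len len' fun _ => 0, ?_,
    fun i j => Finset.mem_image_of_mem len (Finset.mem_univ (i, j)), fun i j => hf (i, j)⟩
  intro l hl l' hl' hll'
  obtain ⟨p, -, rfl⟩ := Finset.mem_image.1 hl
  obtain ⟨q, -, rfl⟩ := Finset.mem_image.1 hl'
  rw [hf, hf]
  exact (h.length_lt _ _ _ _).1 hll'

/-- In an `ℵ₀`-saturated structure every tree-indexed family has a `str`-indiscernible family
realizing its EM-type. -/
theorem exists_indiscernible_strongShelah (hκ : ℵ₀ ≤ κ) (hM : IsSaturated L κ M)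
    (a : SeqTree → Fin n → M) :
    ∃ b : SeqTree → Fin n → M, Satisfies b (EMType L strongShelahLanguage a) ∧
      IsIndiscernible L strongShelahLanguage b := by
  obtain ⟨c, hc, hcind⟩ := exists_indiscernible_shelah hκ hM a
  obtain ⟨b, hb⟩ := exists_realize_ultrafilter hκ hM (genericUltrafilter ℕ)
    fun t (p : SeqTree × Fin n) => c (stretch (increasing t) p.1) p.2
  have hb' : ∀ {k : ℕ} (φ : L.Formula (Fin k × Fin n)) (η : Fin k → SeqTree),
      φ.Realize (fun p => b (η p.1, p.2)) ↔ ∀ᶠ t in (genericUltrafilter ℕ : Filter _),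
        φ.Realize fun p => c (stretch (increasing t) (η p.1)) p.2 := fun φ η => by
    have := hb (φ.relabel fun p => (η p.1, p.2))
    simp only [Formula.realize_relabel] at this
    exact this
  refine ⟨fun i j => b (i, j), ?_, ?_⟩
  · rintro ψ ⟨k, ι, φ, rfl, hφ⟩
    rw [Formula.realize_relabel]
    refine (hb' φ ι).2 (Eventually.of_forall fun t => ?_)
    -- A tuple $s$-similar to the stretched `ι` is $\mathrm{str}$-similar to `ι`, so the formula at
    -- the stretched indices already belongs to the $s$-EM-type of `a`, which `c` realizes.
    have hsim := orderSimilar_stretch (strictMono_increasing t) ι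
    have := hc (φ.relabel fun p => (stretch (increasing t) (ι p.1), p.2))
      ⟨k, fun i => stretch (increasing t) (ι i), φ, rfl, fun η hη => hφ η ?_⟩
    · rwa [Formula.realize_relabel] at this
    · rw [sameQFType_shelah_iff] at hη
      exact sameQFType_strongShelah_iff.2 (hη.orderSimilar.trans hsim)
  · intro k η ν h φ
    rw [sameQFType_strongShelah_iff] at h
    rw [hb', hb']
    -- By $s$-indiscernibility of `c`, the truth value at the stretched tuple depends only on its
    -- order type and its meet lengths. `Q` expresses it through the values of `t` at finitely many
    -- levels, which is the form that an isomorphism of levels can transport.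
    let Q : (Fin k → SeqTree) → (ℕ → ℕ) → Prop := fun η t => ∀ ξ : Fin k → SeqTree,
      OrderSimilar ξ η → (∀ i j, (meet (ξ i) (ξ j)).length = t (meet (η i) (η j)).length) →
        φ.Realize fun p => c (ξ p.1) p.2
    have hQ : ∀ η : Fin k → SeqTree, ∀ᶠ t in (genericUltrafilter ℕ : Filter _),
        (φ.Realize fun p => c (stretch (increasing t) (η p.1)) p.2) ↔ Q η t := by
      intro η
      obtain ⟨N, hN⟩ : ∃ N, ∀ i, (η i).length ≤ N :=
        ⟨Finset.univ.sup fun i => (η i).length, fun i =>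
          Finset.le_sup (f := fun i => (η i).length) (Finset.mem_univ i)⟩
      filter_upwards [eventually_strictMonoOn (Finset.Iic N)] with t ht
      have hmono := strictMono_increasing t
      have hlen : ∀ i j, (meet (stretch (increasing t) (η i))
          (stretch (increasing t) (η j))).length = t (meet (η i) (η j)).length := fun i j => by
        rw [length_meet_stretch hmono]
        exact increasing_eq ht ((meet_prefix_left _ _).length_le.trans (hN i))
      refine ⟨fun hφ ξ hξ hlξ => ?_, fun hq => hq _ (orderSimilar_stretch hmono η) hlen⟩
      refine (hcind k ξ (fun i => stretch (increasing t) (η i)) ?_ φ).2 hφ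
      rw [sameQFType_shelah_iff]
      exact ⟨fun i j => (hlξ i j).trans (hlen i j).symm,
        (hξ.trans (orderSimilar_stretch hmono η).symm).lt_iff⟩
    rw [eventually_congr (hQ η), eventually_congr (hQ ν)]
    obtain ⟨F, f, hf, hF, hfη⟩ := h.exists_levels_iso
    refine eventually_genericUltrafilter_congr hf fun t t' htt' => ?_
    have hlev : ∀ i j, t (meet (η i) (η j)).length = t' (meet (ν i) (ν j)).length := fun i j => by
      rw [← hfη i j, htt' _ (hF i j)]
    refine forall_congr' fun ξ => ?_
    simp only [hlev]
    exact imp_congr ⟨fun hξ => hξ.trans h, fun hξ => hξ.trans h.symm⟩ Iff.rfl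

end Modeling

/-! ### Transfer of tree properties along EM-types -/

section Transfer

open FirstOrder.Language

theorem consistentFamily_iff {L : FirstOrder.Language.{u, v}} {M : Type w} [L.Structure M]
    {m n : ℕ} {φ : L.Formula (Fin m ⊕ Fin n)} {J : Type} [Finite J] {c : J → Fin n → M} :
    ConsistentFamily φ c ↔ ∃ z : Fin m → M, ∀ j, φ.Realize (Sum.elim z (c j)) := by
  have := Fintype.ofFinite J
  refine ⟨fun h => ?_, fun ⟨z, hz⟩ s => ⟨z, fun j _ => hz j⟩⟩
  obtain ⟨z, hz⟩ := h Finset.univ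
  exact ⟨z, fun j => hz j (Finset.mem_univ j)⟩

/-- The formula in the variables `y₀, …, yₖ₋₁` saying that the formulas `φ(x, yⱼ)` are jointly
satisfiable. -/
noncomputable def consistencyFormula {L : FirstOrder.Language.{u, v}} {m n : ℕ}
    (φ : L.Formula (Fin m ⊕ Fin n)) (k : ℕ) : L.Formula (Fin k × Fin n) :=
  Formula.iExs (Fin m) <| Formula.iInf fun j : Fin k =>
    φ.relabel (Sum.elim Sum.inr fun i => Sum.inl (j, i))

theorem realize_consistencyFormula {L : FirstOrder.Language.{u, v}} {M : Type w} [L.Structure M]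
    {m n k : ℕ} {φ : L.Formula (Fin m ⊕ Fin n)} {c : Fin k → Fin n → M} :
    (consistencyFormula φ k).Realize (fun p => c p.1 p.2) ↔ ConsistentFamily φ c := by
  rw [consistentFamily_iff, consistencyFormula, Formula.realize_iExs]
  refine exists_congr fun z => ?_
  rw [Formula.realize_iInf]
  refine forall_congr' fun j => ?_
  rw [Formula.realize_relabel]
  refine iff_of_eq (congrArg _ (funext fun i => ?_))
  rcases i with i | i <;> rfl

theorem length_restrict (μ : ℕ → ℕ) (i : ℕ) : (restrict μ i).length = i := by
  simp [restrict]

theorem restrict_prefix (μ : ℕ → ℕ) {i j : ℕ} (h : i ≤ j) : restrict μ i <+: restrict μ j := by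
  rw [List.prefix_iff_eq_take]
  refine List.ext_getElem (by simp [restrict, h]) fun l h₁ h₂ => ?_
  simp [restrict]

/-- The last node of the chain is continued by zeros. -/
theorem exists_branch {k : ℕ} {η : Fin k → SeqTree} (h : ∀ i j, i ≤ j → η i <+: η j) :
    ∃ μ : ℕ → ℕ, ∀ i, η i = restrict μ (η i).length := by
  cases k with
  | zero => exact ⟨fun _ => 0, fun i => i.elim0⟩
  | succ k =>
    refine ⟨fun l => (η (Fin.last k)).getD l 0, fun i => ?_⟩
    have hp := h i _ (Fin.le_last i)
    refine List.ext_getElem (length_restrict _ _).symm fun l h₁ h₂ => ?_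
    have hl := h₁.trans_le hp.length_le
    simp [restrict, hl, hp.getElem h₁]

/-- A realization of the EM-type of a witness of a tree property is a witness, if the language
recognizes chains and the tuples of the given kind. -/
theorem WitnessesTreeProperty.of_satisfies_emType {L : FirstOrder.Language.{u, v}}
    {L' : FirstOrder.Language.{0, 0}} [L'.Structure SeqTree] {M : Type w} [L.Structure M]
    {m n k : ℕ} {S : (Fin k → SeqTree) → Prop} {φ : L.Formula (Fin m ⊕ Fin n)}
    {a b : SeqTree → Fin n → M} (ha : WitnessesTreeProperty S φ a)
    (hb : Satisfies b (EMType L L' a))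
    (hsim : ∀ {N : ℕ} {η ν : Fin N → SeqTree}, SameQFType L' η ν → OrderSimilar η ν)
    (hS : ∀ {η ν : Fin k → SeqTree}, SameQFType L' η ν → S ν → S η) :
    WitnessesTreeProperty S φ b := by
  have hb' : ∀ {N : ℕ} (η : Fin N → SeqTree) (θ : L.Formula (Fin N × Fin n)),
      (∀ ν, SameQFType L' ν η → θ.Realize fun p => a (ν p.1) p.2) →
        θ.Realize fun p => b (η p.1) p.2 := fun {N} η θ hθ => by
    have := hb (θ.relabel fun p => (η p.1, p.2)) ⟨N, η, θ, rfl, hθ⟩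
    rw [Formula.realize_relabel] at this
    exact this
  refine ⟨fun μ s => ?_, fun η hη hcon => ?_⟩
  · obtain ⟨N, hN⟩ : ∃ N, ∀ i ∈ s, i < N :=
      ⟨s.sup id + 1, fun i hi => Nat.lt_succ_of_le (Finset.le_sup (f := id) hi)⟩
    have := hb' (fun i : Fin N => restrict μ i) (consistencyFormula φ N) fun ν hν => by
      have hchain : ∀ i j : Fin N, i ≤ j → ν i <+: ν j := fun i j hij =>
        ((hsim hν).prefix_iff (x := ν i) (y := ν j)
          ⟨i, i, (meet_self _).symm, (meet_self _).symm⟩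
          ⟨j, j, (meet_self _).symm, (meet_self _).symm⟩).2 (restrict_prefix μ hij)
      obtain ⟨μ', hμ'⟩ := exists_branch hchain
      refine (realize_consistencyFormula (c := fun i => a (ν i))).2 (consistentFamily_iff.2 ?_)
      -- The similar chain may skip levels of its branch, which does no harm because consistency
      -- holds for any finite set of levels.
      obtain ⟨z, hz⟩ := ha.1 μ' (Finset.univ.image fun i => (ν i).length)
      refine ⟨z, fun i => ?_⟩
      rw [hμ' i]
      exact hz _ (Finset.mem_image_of_mem _ (Finset.mem_univ i))
    obtain ⟨z, hz⟩ := consistentFamily_iff.1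
      ((realize_consistencyFormula (c := fun i : Fin N => b (restrict μ i))).1 this)
    exact ⟨z, fun i hi => hz ⟨i, hN i hi⟩⟩
  · refine hb' η (consistencyFormula φ k).not (fun ν hν => ?_)
      ((realize_consistencyFormula (c := fun i => b (η i))).2 hcon)
    exact fun h => ha.2 ν (hS hν hη) ((realize_consistencyFormula (c := fun i => a (ν i))).1 h)

theorem OrderSimilar.arePairwiseIncomparable {k : ℕ} {η ν : Fin k → SeqTree}
    (h : OrderSimilar η ν) (hν : ArePairwiseIncomparable ν) : ArePairwiseIncomparable η :=
  fun i j hij hp => hν i j hij <| (h.prefix_iff ⟨i, i, (meet_self _).symm, (meet_self _).symm⟩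
    ⟨j, j, (meet_self _).symm, (meet_self _).symm⟩).1 hp

/-- Nodes that properly extend a node of the same length as their pairwise meets extend distinct
immediate successors of it. -/
theorem exists_injective_successor {k : ℕ} {η : Fin k → SeqTree} {ξ : SeqTree}
    (hp : ∀ i, ξ <+: η i) (hlt : ∀ i, ξ.length < (η i).length)
    (hm : ∀ i j, i ≠ j → (meet (η i) (η j)).length = ξ.length) :
    ∃ t : Fin k → ℕ, t.Injective ∧ ∀ i, ξ ++ [t i] <+: η i := by
  have hpre : ∀ i, ξ ++ [(η i)[ξ.length]'(hlt i)] <+: η i := fun i => by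
    obtain ⟨s, hs⟩ := hp i
    have hlt' := hlt i
    cases s with
    | nil => simp [← hs] at hlt'
    | cons c s => simp [← hs]
  refine ⟨fun i => (η i)[ξ.length]'(hlt i), fun i j hij => ?_, hpre⟩
  by_contra hne
  have h₁ := hpre i
  have hij' : (η i)[ξ.length]'(hlt i) = (η j)[ξ.length]'(hlt j) := hij
  rw [hij'] at h₁
  have := ((prefix_meet_iff _ _ _).2 ⟨h₁, hpre j⟩).length_le
  rw [hm i j hne] at this
  simp at this

theorem length_meet_of_prefix {ξ η ν : SeqTree} {s t : ℕ} (hst : s ≠ t) (hη : ξ ++ [s] <+: η)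
    (hν : ξ ++ [t] <+: ν) : (meet η ν).length = ξ.length := by
  have hm : meet (ξ ++ [s]) (ξ ++ [t]) = ξ := by
    rw [meet_append, meet, if_neg hst, List.append_nil]
  refine le_antisymm (le_of_not_gt fun hlt => ?_) ?_
  · have h₁ := List.prefix_of_prefix_length_le hη (meet_prefix_left η ν) (by simpa using hlt)
    have h₂ := List.prefix_of_prefix_length_le hν (meet_prefix_right η ν) (by simpa using hlt)
    have := List.prefix_of_prefix_length_le h₁ h₂ (by simp)
    simpa [hst] using this.eq_of_length (by simp)
  · exact ((prefix_meet_iff _ _ _).2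
      ⟨(List.prefix_append _ _).trans hη, (List.prefix_append _ _).trans hν⟩).length_le

/-- Distant siblings are recognized by pairwise meets of one common length, each entry being
strictly longer. A pair of distinct indices is needed to name that meet: for `k = 1` the root is
similar to every node, yet is no distant sibling. -/
theorem OrderSimilar.areDistantSiblings {k : ℕ} (hk : 2 ≤ k) {η ν : Fin k → SeqTree}
    (h : OrderSimilar η ν) (hν : AreDistantSiblings ν) : AreDistantSiblings η := by
  obtain ⟨ξ, t, ht, hp⟩ := hν
  have hm : ∀ i j, i ≠ j → (meet (ν i) (ν j)).length = ξ.length := fun i j hij =>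
    length_meet_of_prefix (ht.ne hij) (hp i) (hp j)
  have hlt : ∀ i, ξ.length < (ν i).length := fun i => by simpa using (hp i).length_le
  let p : Fin k := ⟨0, by omega⟩
  let q : Fin k := ⟨1, by omega⟩
  have hpq : p ≠ q := by simp [p, q]
  have hm' : ∀ i j, i ≠ j → (meet (η i) (η j)).length = (meet (η p) (η q)).length :=
    fun i j hij => (h.length_eq i j p q).2 ((hm i j hij).trans (hm p q hpq).symm)
  refine ⟨_, exists_injective_successor (ξ := meet (η p) (η q)) (fun i => ?_) (fun i => ?_) hm'⟩
  · by_cases hi : p = i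
    · exact hi ▸ meet_prefix_left _ _
    · refine List.IsPrefix.trans ?_ (meet_prefix_right (η p) (η i))
      exact List.prefix_of_prefix_length_le (meet_prefix_left _ _) (meet_prefix_left _ _)
        (hm' p i hi).ge
  · have := (h.length_lt p q i i).2 (by rw [hm p q hpq, meet_self]; exact hlt i)
    rwa [meet_self] at this

/-- Siblings all have length one more than their pairwise meets. This needs exact levels: a
$\mathrm{str}$-similar tuple may be longer by any amount. -/
theorem LevelSimilar.areSiblings {k : ℕ} {η ν : Fin k → SeqTree} (h : LevelSimilar η ν)
    (hν : AreSiblings ν) : AreSiblings η := by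
  rcases k with _ | k
  · exact ⟨[], fun i => i.elim0, fun i => i.elim0, fun i => i.elim0⟩
  obtain ⟨ξ, t, ht, hp⟩ := hν
  have hlen : ∀ i, (η i).length = ξ.length + 1 := fun i => by rw [h.length, hp]; simp
  have hm : ∀ i j, i ≠ j → (meet (η i) (η j)).length = ξ.length := fun i j hij => by
    rw [h.length_meet]
    exact length_meet_of_prefix (ht.ne hij) (hp i ▸ List.prefix_rfl) (hp j ▸ List.prefix_rfl)
  have hl : ((η 0).take ξ.length).length = ξ.length := by simp [hlen 0]
  have hpre : ∀ i, (η 0).take ξ.length <+: η i := fun i => by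
    by_cases hi : 0 = i
    · exact hi ▸ List.take_prefix _ _
    · exact (List.prefix_of_prefix_length_le (List.take_prefix _ _) (meet_prefix_left _ (η i))
        (by rw [hl, hm 0 i hi])).trans (meet_prefix_right _ _)
  obtain ⟨t', ht', hp'⟩ := exists_injective_successor (ξ := (η 0).take ξ.length) (η := η)
    hpre (fun i => by rw [hl, hlen]; omega) fun i j hij => (hm i j hij).trans hl.symm
  exact ⟨_, t', ht', fun i => ((hp' i).eq_of_length (by simp [hlen])).symm⟩

/-- A witness of weak `k`-TP₁ exists only for `k ≥ 2`. -/
theorem WitnessesWeakTP1.two_le {L : FirstOrder.Language.{u, v}} {M : Type w} [L.Structure M]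
    [Nonempty M] {m n k : ℕ} {φ : L.Formula (Fin m ⊕ Fin n)} {a : SeqTree → Fin n → M}
    (h : WitnessesWeakTP1 k φ a) : 2 ≤ k := by
  by_contra hk
  have hk' : ∀ i j : Fin k, i = j := fun i j => Fin.ext (by omega)
  -- For `k ≤ 1` the constant tuple at a node of level 1 counts as distant siblings, yet its formula
  -- is consistent because the node lies on a branch.
  refine h.2 (fun _ => restrict (fun _ => 0) 1)
    ⟨[], fun _ => 0, fun i j _ => hk' i j, fun _ => by simp [restrict]⟩ ?_
  obtain ⟨z, hz⟩ := h.1 (fun _ => 0) {1}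
  exact consistentFamily_iff.2 ⟨z, fun _ => hz 1 (Finset.mem_singleton_self 1)⟩

end Transfer

end TreeIndisc

theorem mainTheorem3 (L : FirstOrder.Language.{u, v}) (T : L.Theory) (hT : T.IsComplete)
    (M : Type (max u v w)) [Nonempty M] [L.Structure M] (hMT : M ⊨ T)
    (κ : Cardinal.{max u v w}) (hκ : ℵ₀ ≤ κ) (hM : IsSaturated L κ M) :
    (∀ (P : L.Theory → Prop) (ι : Type x) (Γ : ι → TreePartialType L),
      IsTypeProperty.{u, v, w, x} L shelahLanguage P Γ →
      ∀ (i : ι) (a : SeqTree → Fin (Γ i).arity → M),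
        Satisfies a (Γ i).formulas →
        ∃ b : SeqTree → Fin (Γ i).arity → M,
          Satisfies b (Γ i).formulas ∧
          IsIndiscernible L shelahLanguage b) ∧
    (∀ (P : L.Theory → Prop) (ι : Type x) (Γ : ι → TreePartialType L),
      IsTypeProperty.{u, v, w, x} L strongShelahLanguage P Γ →
      ∀ (i : ι) (a : SeqTree → Fin (Γ i).arity → M),
        Satisfies a (Γ i).formulas →
        ∃ b : SeqTree → Fin (Γ i).arity → M,
          Satisfies b (Γ i).formulas ∧
          IsIndiscernible L strongShelahLanguage b) ∧
    (∀ (k m n : ℕ) (φ : L.Formula (Fin m ⊕ Fin n)) (a : SeqTree → Fin n → M),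
      WitnessesTP k φ a →
      ∃ b : SeqTree → Fin n → M, WitnessesTP k φ b ∧
        IsIndiscernible L shelahLanguage b) ∧
    (∀ (k m n : ℕ) (φ : L.Formula (Fin m ⊕ Fin n)) (a : SeqTree → Fin n → M),
      WitnessesTP1 k φ a →
      ∃ b : SeqTree → Fin n → M, WitnessesTP1 k φ b ∧
        IsIndiscernible L strongShelahLanguage b) ∧
    (∀ (k m n : ℕ) (φ : L.Formula (Fin m ⊕ Fin n)) (a : SeqTree → Fin n → M),
      WitnessesWeakTP1 k φ a →
      ∃ b : SeqTree → Fin n → M, WitnessesWeakTP1 k φ b ∧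
        IsIndiscernible L strongShelahLanguage b) := by
  refine ⟨?_, ?_, ?_, ?_, ?_⟩
  · rintro P ι Γ ⟨Q, -, hQ⟩ i a ha
    obtain ⟨b, hb, hind⟩ := exists_indiscernible_shelah hκ hM a
    -- Condition (2) is applied with both families in the same structure, and for the given
    -- disjunct, so the disjunct is preserved.
    exact ⟨b, (hQ i).em_implies M a ha M b hb, hind⟩
  · rintro P ι Γ ⟨Q, -, hQ⟩ i a ha
    obtain ⟨b, hb, hind⟩ := exists_indiscernible_strongShelah hκ hM a
    exact ⟨b, (hQ i).em_implies M a ha M b hb, hind⟩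
  · intro k m n φ a ha
    obtain ⟨b, hb, hind⟩ := exists_indiscernible_shelah hκ hM a
    exact ⟨b, ha.of_satisfies_emType hb (fun h => (sameQFType_shelah_iff.1 h).orderSimilar)
      fun h => (sameQFType_shelah_iff.1 h).areSiblings, hind⟩
  · intro k m n φ a ha
    obtain ⟨b, hb, hind⟩ := exists_indiscernible_strongShelah hκ hM a
    exact ⟨b, ha.of_satisfies_emType hb sameQFType_strongShelah_iff.1
      fun h => (sameQFType_strongShelah_iff.1 h).arePairwiseIncomparable, hind⟩
  · intro k m n φ a ha
    obtain ⟨b, hb, hind⟩ := exists_indiscernible_strongShelah hκ hM a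
    exact ⟨b, ha.of_satisfies_emType hb sameQFType_strongShelah_iff.1
      fun h => (sameQFType_strongShelah_iff.1 h).areDistantSiblings ha.two_le, hind⟩
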